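/- Let $1\le k\le n$ and let $X_1,\dots,X_n$ be real random variables on a probability space, with ordered values $X_{1:n}\le\dots\le X_{n:n}$. Suppose that their joint distribution is symmetric (invariant under all permutations of the coordinates) and multivariate totally positive of order two (MTP$_2$): with respect to some product $\nu_1\otimes\dots\otimes\nu_n$ of $\sigma$-finite measures on $\mathbb R$ (for example Lebesgue measure on $\mathbb R^n$) it has a density $f$ such that $f(x)f(y)\le f(x\vee y)f(x\wedge y)$ for all $x,y\in\mathbb R^n$, where $\vee$ and $\wedge$ are the coordinatewise maximum and minimum. Then the maximum of any $k$ of the $X_i$ has a cdf $F_k$, and the minimum of any $k$ of the $X_i$ has a cdf $G_k$, that do not depend on the choice of the $k$ variables, and the following hold. (a) Let $a_k\le\dots\le a_n$ be real numbers. If $\binom{j}{k}^{-1}F_k(a_j)$ is nondecreasing in $j=k,\dots,n$, then $$P\{X_{k:n}\ge a_k,\dots,X_{n:n}\ge a_n\}\ \ge\ 1-F_k(a_n).$$ Equality holds if the $X_i$ are independent, have continuous marginal cdfs, and $\binom{j}{k}^{-1}F_k(a_j)$ is constant in $j=k,\dots,n$. (b) Let $b_1\le\dots\le b_{n-k+1}$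 be real numbers. If $\binom{j}{k}^{-1}\bigl[1-G_k(b_{n-j+1})\bigr]$ is nondecreasing in $j=k,\dots,n$, then $$P\{X_{1:n}\le b_1,\dots,X_{n-k+1:n}\le b_{n-k+1}\}\ \ge\ G_k(b_1).$$ Equality holds if the $X_i$ are independent and $\binom{j}{k}^{-1}\bigl[1-G_k(b_{n-j+1})\bigr]$ is constant in $j=k,\dots,n$. -/

import Mathlib

open MeasureTheory ProbabilityTheory
open scoped NNReal ENNReal

/-- The order statistics `x_{1:n} ≤ … ≤ x_{n:n}` of a real vector: `orderStat x i` is the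
`(i + 1)`-th smallest entry of `x`, that is, `x_{i+1:n}` (the index `i : Fin n` starts at `0`). -/
noncomputable def orderStat {n : ℕ} (x : Fin n → ℝ) (i : Fin n) : ℝ :=
  x (Tuple.sort x i)

/-- A measure on `ℝⁿ` is symmetric (exchangeable) if it is invariant under all permutations of
the coordinates. -/
def IsSymmetricLaw {n : ℕ} (μ : Measure (Fin n → ℝ)) : Prop :=
  ∀ σ : Equiv.Perm (Fin n), μ.map (fun x i => x (σ i)) = μ

/-- A measure on `ℝⁿ` is multivariate totally positive of order two (MTP₂) if, with respect to
some product of σ-finite measures on the line (Lebesgue measure, for instance), it has a density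
`f` with `f x * f y ≤ f (x ∨ y) * f (x ∧ y)` for all `x` and `y`, where `∨` and `∧` are the
coordinatewise maximum and minimum. -/
def IsMTP2 {n : ℕ} (μ : Measure (Fin n → ℝ)) : Prop :=
  ∃ ν : Fin n → Measure ℝ, (∀ i, SigmaFinite (ν i)) ∧
    ∃ f : (Fin n → ℝ) → ℝ≥0, Measurable f ∧
      (∀ x y, f x * f y ≤ f (x ⊔ y) * f (x ⊓ y)) ∧
      μ = (Measure.pi ν).withDensity (fun x => (f x : ℝ≥0∞))

/-- The cumulative distribution function `x ↦ P {max_{i ∈ s} X_i ≤ x}`. -/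
noncomputable def maxCDF {n : ℕ} {Ω : Type*} [MeasurableSpace Ω] (P : Measure Ω)
    (X : Fin n → Ω → ℝ) (s : Finset (Fin n)) (hs : s.Nonempty) (x : ℝ) : ℝ :=
  cdf (P.map (fun ω => s.sup' hs (fun i => X i ω))) x

/-- The cumulative distribution function `x ↦ P {min_{i ∈ s} X_i ≤ x}`. -/
noncomputable def minCDF {n : ℕ} {Ω : Type*} [MeasurableSpace Ω] (P : Measure Ω)
    (X : Fin n → Ω → ℝ) (s : Finset (Fin n)) (hs : s.Nonempty) (x : ℝ) : ℝ :=
  cdf (P.map (fun ω => s.inf' hs (fun i => X i ω))) x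

/-! The complement of the event in (a) says that for some level j ≥ k at least j of the variables
lie below a_j. Split it by the last such level: there exactly j variables lie below a_j, so its
probability is C(j,k)⁻¹ times a sum over k-sets s of the probability that it occurs together with
A_j = {all variables of s lie below a_j}. On A_j the levels from j on only involve the variables
outside s, through a decreasing chain of events L_j, and the s-term becomes ∑_j C(j,k)⁻¹ P(A_j ∩
(L_j \ L_{j+1})) (`measureReal_stepUpEvent_eq`). MTP₂ enters only through P(L_{j+1} | A_{j+1}) ≤
P(L_{j+1} | A_j) (`IsMTP2.stepUpEvent_inter_mul_le`), a consequence of the four functions theorem.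
With P(A_j)/C(j,k) nondecreasing, summation by parts bounds each s-term by P(A_n)/C(n,k)
(`sum_mul_sub_le_of_monotoneOn`), and the C(n,k) sets s give F_k(a_n). Under independence and
constant ratios the sum telescopes exactly. Part (b) is the same argument with upper half-lines. -/

/-! ### The four functions theorem. -/

/-- In `ℝ≥0∞`, two numbers below `c` whose product is at most `c * d` have sum at most `c + d`. -/
theorem ENNReal.add_le_add_of_mul_le_mul {a b c d : ℝ≥0∞} (ha : a ≤ c) (hb : b ≤ c)
    (h : a * b ≤ c * d) : a + b ≤ c + d := by
  rcases eq_or_ne c ⊤ with rfl | hc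
  · simp
  rcases eq_or_ne d ⊤ with rfl | hd
  · simp
  lift c to ℝ≥0 using hc
  lift d to ℝ≥0 using hd
  lift a to ℝ≥0 using ne_top_of_le_ne_top ENNReal.coe_ne_top ha
  lift b to ℝ≥0 using ne_top_of_le_ne_top ENNReal.coe_ne_top hb
  norm_cast at *
  rcases eq_or_ne c 0 with rfl | h0
  · simp_all
  have hc : (0 : ℝ) < c := by positivity
  have ha' : (a : ℝ) ≤ c := ha
  have hb' : (b : ℝ) ≤ c := hb
  have h' : (a : ℝ) * b ≤ c * d := by exact_mod_cast h
  have : (a : ℝ) + b ≤ c + d := by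
    -- Expanding (c - a)(c - b) ≥ 0 gives c(a + b) ≤ c² + ab ≤ c(c + d).
    refine le_of_mul_le_mul_left ?_ hc
    nlinarith [mul_nonneg (sub_nonneg.2 ha') (sub_nonneg.2 hb')]
  exact_mod_cast this

/-- The four functions theorem on a linear order with a σ-finite measure. -/
theorem lintegral_mul_lintegral_le_of_linearOrder {α : Type*} [LinearOrder α] [MeasurableSpace α]
    (ν : Measure α) [SigmaFinite ν] {f₁ f₂ f₃ f₄ : α → ℝ≥0∞} (h₁ : Measurable f₁)
    (h₂ : Measurable f₂) (h₃ : Measurable f₃) (h₄ : Measurable f₄)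
    (h : ∀ x y, f₁ x * f₂ y ≤ f₃ (x ⊔ y) * f₄ (x ⊓ y)) :
    (∫⁻ x, f₁ x ∂ν) * ∫⁻ x, f₂ x ∂ν ≤ (∫⁻ x, f₃ x ∂ν) * ∫⁻ x, f₄ x ∂ν := by
  -- Symmetrised in (x, y), the claim holds pointwise; integrating over `ν.prod ν` yields twice the
  -- desired inequality. For x ≤ y both left terms are at most c = f₃(y) f₄(x), and their product is
  -- at most c · f₃(x) f₄(y).
  have key : ∀ x y, f₁ x * f₂ y + f₁ y * f₂ x ≤ f₃ x * f₄ y + f₃ y * f₄ x := by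
    have aux : ∀ x y, x ≤ y → f₁ x * f₂ y + f₁ y * f₂ x ≤ f₃ y * f₄ x + f₃ x * f₄ y := by
      intro x y hxy
      have e₁ := h x y
      have e₂ := h y x
      have e₃ := h x x
      have e₄ := h y y
      simp only [sup_of_le_left, inf_of_le_right, sup_of_le_right, inf_of_le_left, hxy, le_refl]
        at e₁ e₂ e₃ e₄
      refine ENNReal.add_le_add_of_mul_le_mul e₁ e₂ ?_
      calc f₁ x * f₂ y * (f₁ y * f₂ x) = (f₁ x * f₂ x) * (f₁ y * f₂ y) := by ring
        _ ≤ (f₃ x * f₄ x) * (f₃ y * f₄ y) := mul_le_mul' e₃ e₄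
        _ = _ := by ring
    intro x y
    rcases le_total x y with hxy | hxy
    · rw [add_comm (f₃ x * f₄ y)]
      exact aux x y hxy
    · rw [add_comm (f₁ x * f₂ y)]
      exact aux y x hxy
  have symm : ∀ {g g' : α → ℝ≥0∞}, Measurable g → Measurable g' →
      ∫⁻ z, g z.1 * g' z.2 + g z.2 * g' z.1 ∂ν.prod ν
        = 2 * ((∫⁻ x, g x ∂ν) * ∫⁻ x, g' x ∂ν) := by
    intro g g' hg hg'
    rw [lintegral_add_left (by fun_prop), lintegral_prod_mul hg.aemeasurable hg'.aemeasurable]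
    simp_rw [mul_comm (g _)]
    rw [lintegral_prod_mul hg'.aemeasurable hg.aemeasurable]
    ring
  have := lintegral_mono (μ := ν.prod ν) (fun z : α × α => key z.1 z.2)
  rw [symm h₁ h₂, symm h₃ h₄] at this
  exact (ENNReal.mul_le_mul_iff_right (by simp) (by simp)).1 this

/-- The four functions theorem (Ahlswede–Daykin, Karlin–Rinott) for a product of σ-finite measures
on the line. -/
theorem lintegral_mul_lintegral_le_of_pi : ∀ {n : ℕ} (ν : Fin n → Measure ℝ)
    [∀ i, SigmaFinite (ν i)] {f₁ f₂ f₃ f₄ : (Fin n → ℝ) → ℝ≥0∞}, Measurable f₁ → Measurable f₂ →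
    Measurable f₃ → Measurable f₄ →
    (∀ x y, f₁ x * f₂ y ≤ f₃ (x ⊔ y) * f₄ (x ⊓ y)) →
    (∫⁻ x, f₁ x ∂Measure.pi ν) * ∫⁻ x, f₂ x ∂Measure.pi ν
      ≤ (∫⁻ x, f₃ x ∂Measure.pi ν) * ∫⁻ x, f₄ x ∂Measure.pi ν
  | 0, ν, _, f₁, f₂, f₃, f₄, h₁, h₂, h₃, h₄, h => by
    simp only [Measure.pi_of_empty ν default, lintegral_dirac' _ h₁, lintegral_dirac' _ h₂,
      lintegral_dirac' _ h₃, lintegral_dirac' _ h₄]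
    simpa only [sup_idem, inf_idem] using h default default
  | n + 1, ν, _, f₁, f₂, f₃, f₄, h₁, h₂, h₃, h₄, h => by
    have hcons : Measurable fun p : ℝ × (Fin n → ℝ) => (Fin.cons p.1 p.2 : Fin (n + 1) → ℝ) :=
      measurable_pi_iff.2 fun i => Fin.cases (by simpa using measurable_fst)
        (fun j => by simp only [Fin.cons_succ]; fun_prop) i
    have slice : ∀ {g : (Fin (n + 1) → ℝ) → ℝ≥0∞}, Measurable g →
        ∫⁻ x, g x ∂Measure.pi ν
          = ∫⁻ y, ∫⁻ t, g (Fin.cons t y) ∂ν 0 ∂Measure.pi fun j => ν (Fin.succ j) := by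
      intro g hg
      have e : ∀ p : ℝ × (Fin n → ℝ),
          (MeasurableEquiv.piFinSuccAbove (fun _ : Fin (n + 1) => ℝ) 0).symm p
            = (Fin.cons p.1 p.2 : Fin (n + 1) → ℝ) := fun p => by
        simp [MeasurableEquiv.piFinSuccAbove]
        rfl
      rw [← ((measurePreserving_piFinSuccAbove ν 0).symm).lintegral_comp hg]
      simp only [e]
      exact lintegral_prod_symm' _ (hg.comp hcons)
    have marg : ∀ {g : (Fin (n + 1) → ℝ) → ℝ≥0∞}, Measurable g →
        Measurable fun y => ∫⁻ t, g (Fin.cons t y) ∂ν 0 :=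
      fun hg => (hg.comp hcons).lintegral_prod_left'
    have section_meas : ∀ {g : (Fin (n + 1) → ℝ) → ℝ≥0∞}, Measurable g → ∀ y : Fin n → ℝ,
        Measurable fun t : ℝ => g (Fin.cons t y) :=
      fun hg y => (hg.comp hcons).comp measurable_prodMk_right
    rw [slice h₁, slice h₂, slice h₃, slice h₄]
    -- Integrating out coordinate 0 preserves the four functions hypothesis, by the one-dimensional
    -- case.
    refine lintegral_mul_lintegral_le_of_pi _ (marg h₁) (marg h₂) (marg h₃) (marg h₄) fun x y => ?_
    refine lintegral_mul_lintegral_le_of_linearOrder _ (section_meas h₁ x) (section_meas h₂ y)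
      (section_meas h₃ _) (section_meas h₄ _) fun t u => ?_
    convert h (Fin.cons t x) (Fin.cons u y) using 3 <;>
    · ext i
      refine Fin.cases ?_ (fun j => ?_) i <;> simp

/-- The four functions theorem for events under an MTP₂ law. -/
theorem IsMTP2.measure_mul_measure_le {n : ℕ} {μ : Measure (Fin n → ℝ)} (hμ : IsMTP2 μ)
    {S₁ S₂ S₃ S₄ : Set (Fin n → ℝ)} (h₁ : MeasurableSet S₁) (h₂ : MeasurableSet S₂)
    (h₃ : MeasurableSet S₃) (h₄ : MeasurableSet S₄)
    (hsup : ∀ x ∈ S₁, ∀ y ∈ S₂, x ⊔ y ∈ S₃) (hinf : ∀ x ∈ S₁, ∀ y ∈ S₂, x ⊓ y ∈ S₄) :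
    μ S₁ * μ S₂ ≤ μ S₃ * μ S₄ := by
  obtain ⟨ν, hν, f, hf, hfx, rfl⟩ := hμ
  have hm : Measurable fun x => (f x : ℝ≥0∞) := hf.coe_nnreal_ennreal
  rw [withDensity_apply _ h₁, withDensity_apply _ h₂, withDensity_apply _ h₃,
    withDensity_apply _ h₄, ← lintegral_indicator h₁, ← lintegral_indicator h₂,
    ← lintegral_indicator h₃, ← lintegral_indicator h₄]
  refine lintegral_mul_lintegral_le_of_pi ν (hm.indicator h₁) (hm.indicator h₂)
    (hm.indicator h₃) (hm.indicator h₄) fun x y => ?_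
  by_cases hx : x ∈ S₁
  · by_cases hy : y ∈ S₂
    · simp only [Set.indicator_of_mem, hx, hy, hsup x hx y hy, hinf x hx y hy]
      exact_mod_cast hfx x y
    · simp [hy]
  · simp [hx]

/-! ### Counting occurrences and splitting at the last level. -/

open Classical in
/-- The number of the events `E i`, `i ∈ t`, that occur at `ω`. -/
noncomputable def occurrences {Ω ι : Type*} (E : ι → Set Ω) (t : Finset ι) (ω : Ω) : ℕ :=
  (t.filter fun i => ω ∈ E i).card

/-- For some `j` with `l ≤ j ≤ n`, the number of the events `E j i`, `i ∈ t`, that occur is at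
least `j - m`. -/
def stepUpEvent {Ω : Type*} {n : ℕ} (E : ℕ → Fin n → Set Ω) (t : Finset (Fin n)) (m l : ℕ) :
    Set Ω :=
  {ω | ∃ j, l ≤ j ∧ j ≤ n ∧ j ≤ m + occurrences (E j) t ω}

section Combinatorics

variable {Ω : Type*} {n k : ℕ} {E : ℕ → Fin n → Set Ω}

theorem occurrences_eq_sum {ι : Type*} (E : ι → Set Ω) (t : Finset ι) (ω : Ω) :
    occurrences E t ω = ∑ i ∈ t, (E i).indicator (fun _ => 1) ω := by
  classical
  simp [occurrences, Set.indicator_apply]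

theorem occurrences_le_card {ι : Type*} (E : ι → Set Ω) (t : Finset ι) (ω : Ω) :
    occurrences E t ω ≤ t.card := by
  classical
  exact Finset.card_filter_le _ _

theorem occurrences_mono {ι : Type*} {E E' : ι → Set Ω} {ω ω' : Ω} (t : Finset ι)
    (h : ∀ i ∈ t, ω ∈ E i → ω' ∈ E' i) : occurrences E t ω ≤ occurrences E' t ω' := by
  classical
  refine Finset.card_le_card fun i hi => ?_
  simp only [Finset.mem_filter] at hi ⊢
  exact ⟨hi.1, h i hi.1 hi.2⟩

theorem occurrences_add_compl {ι : Type*} [Fintype ι] [DecidableEq ι] (E : ι → Set Ω)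
    (s : Finset ι) (ω : Ω) :
    occurrences E s ω + occurrences E sᶜ ω = occurrences E Finset.univ ω := by
  simp only [occurrences_eq_sum]
  exact Finset.sum_add_sum_compl s _

theorem occurrences_eq_card {ι : Type*} {E : ι → Set Ω} {s : Finset ι} {ω : Ω}
    (h : ω ∈ ⋂ i ∈ s, E i) : occurrences E s ω = s.card := by
  classical
  simp only [Set.mem_iInter] at h
  rw [occurrences, Finset.filter_true_of_mem h]

theorem stepUpEvent_anti (E : ℕ → Fin n → Set Ω) (t : Finset (Fin n)) (m : ℕ) :
    Antitone (stepUpEvent E t m) :=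
  fun _ _ hl _ ⟨j, hj, h⟩ => ⟨j, hl.trans hj, h⟩

theorem stepUpEvent_eq_empty (E : ℕ → Fin n → Set Ω) (t : Finset (Fin n)) (m : ℕ) {l : ℕ}
    (hl : n < l) : stepUpEvent E t m l = ∅ := by
  ext ω
  simp only [stepUpEvent, Set.mem_ofPred_eq, Set.mem_empty_iff_false, iff_false]
  rintro ⟨j, h₁, h₂, -⟩
  omega

theorem stepUpEvent_self_eq_univ (E : ℕ → Fin n → Set Ω) (t : Finset (Fin n)) (hkn : k ≤ n) :
    stepUpEvent E t k k = Set.univ :=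
  Set.eq_univ_of_forall fun _ => ⟨k, le_rfl, hkn, Nat.le_add_right _ _⟩

/-- At the last level `j` where at least `j` events occur, exactly `j` events occur. -/
theorem occurrences_eq_of_mem_stepUpEvent_diff
    (hE : ∀ i, MonotoneOn (fun j => E j i) (Set.Icc k n)) {j : ℕ} (hkj : k ≤ j) {ω : Ω}
    (h : ω ∈ stepUpEvent E Finset.univ 0 j) (h' : ω ∉ stepUpEvent E Finset.univ 0 (j + 1)) :
    occurrences (E j) Finset.univ ω = j := by
  obtain ⟨l, hjl, hln, hl⟩ := h
  have hlj : l = j := by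
    by_contra hne
    exact h' ⟨l, by omega, hln, hl⟩
  subst hlj
  refine le_antisymm ?_ (by simpa using hl)
  by_contra! hlt
  -- More than l occurrences are impossible at l = n; for l < n they persist at level l + 1, which
  -- then would also qualify.
  rcases hln.eq_or_lt with rfl | hlt'
  · have := occurrences_le_card (E l) Finset.univ ω
    simp at this
    omega
  · refine h' ⟨l + 1, le_rfl, hlt', ?_⟩
    have := occurrences_mono (E := E l) (E' := E (l + 1)) (ω := ω) (ω' := ω) Finset.univ
      fun i _ hi => hE i ⟨hkj, hln⟩ ⟨by omega, hlt'⟩ (Nat.le_succ l) hi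
    omega

/-- If the events indexed by the `k`-set `s` occur at level `j`, then beyond level `j` only the
other events matter. -/
theorem mem_stepUpEvent_univ_iff (hE : ∀ i, MonotoneOn (fun j => E j i) (Set.Icc k n))
    {s : Finset (Fin n)} (hs : s.card = k) {j l : ℕ} (hkj : k ≤ j) (hjl : j ≤ l) {ω : Ω}
    (hω : ω ∈ ⋂ i ∈ s, E j i) :
    ω ∈ stepUpEvent E Finset.univ 0 l ↔ ω ∈ stepUpEvent E sᶜ k l := by
  -- By monotonicity all events of `s` still occur at level m ≥ j, contributing exactly k to the
  -- count.
  have key : ∀ m, l ≤ m → m ≤ n →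
      occurrences (E m) Finset.univ ω = k + occurrences (E m) sᶜ ω := by
    intro m hlm hmn
    rw [← occurrences_add_compl (E m) s, occurrences_eq_card, hs]
    simp only [Set.mem_iInter] at hω ⊢
    exact fun i hi => hE i ⟨hkj, by omega⟩ ⟨by omega, hmn⟩ (by omega) (hω i hi)
  constructor
  · rintro ⟨m, h₁, h₂, h₃⟩
    exact ⟨m, h₁, h₂, by rw [← key m h₁ h₂]; omega⟩
  · rintro ⟨m, h₁, h₂, h₃⟩
    exact ⟨m, h₁, h₂, by rw [key m h₁ h₂]; omega⟩

end Combinatorics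

/-! ### Summation by parts and the Simes bound for families of events. -/

/-- The elementary inequality behind the generalized Simes inequality. -/
theorem sum_mul_sub_le_of_monotoneOn {k n : ℕ} (hkn : k ≤ n) {c p v w : ℕ → ℝ}
    (hc : ∀ j, k ≤ j → j ≤ n → 0 ≤ c j)
    (hv : ∀ j, k ≤ j → j ≤ n → v j ≤ p j)
    (hw : ∀ j, k ≤ j → j ≤ n → 0 ≤ w j)
    (hvw : ∀ j, k ≤ j → j < n → v (j + 1) * p j ≤ w j * p (j + 1))
    (hpm : ∀ j, k ≤ j → j < n → p j = 0 ∨ 0 < p (j + 1))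
    (hq : MonotoneOn (fun j => c j * p j) (Set.Icc k n)) :
    ∑ j ∈ Finset.Ico k (n + 1), c j * (v j - w j) ≤ c n * p n := by
  -- The term - c m * w m is kept for the induction: it pays for v (m + 1) at the next step.
  have main : ∀ m, k ≤ m → m ≤ n →
      ∑ j ∈ Finset.Ico k (m + 1), c j * (v j - w j) ≤ c m * p m - c m * w m := by
    intro m hkm
    induction m, hkm using Nat.le_induction with
    | base =>
      intro _
      have := mul_le_mul_of_nonneg_left (hv k le_rfl hkn) (hc k le_rfl hkn)
      simp
      linarith
    | succ m hkm ih =>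
      intro hmn
      have ih := ih (by omega)
      rw [Finset.sum_Ico_succ_top (by omega)]
      have key : c m * (p m - w m) ≤ c (m + 1) * (p (m + 1) - v (m + 1)) := by
        have hcm := hc m hkm (by omega)
        have hvp := hv (m + 1) (by omega) hmn
        -- For p m = 0 the left side is nonpositive. Otherwise `hvw` can be divided by p (m + 1),
        -- giving c m * w m ≥ (c m * p m) * v (m + 1) / p (m + 1).
        rcases hpm m hkm hmn with h0 | hpos
        · have h1 := hw m hkm (by omega)
          have h2 : c m * (p m - w m) ≤ 0 :=
            mul_nonpos_of_nonneg_of_nonpos hcm (by linarith)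
          exact h2.trans (mul_nonneg (hc _ (by omega) hmn) (by linarith))
        · have hqm : c m * p m ≤ c (m + 1) * p (m + 1) :=
            hq ⟨hkm, by omega⟩ ⟨by omega, hmn⟩ (Nat.le_succ m)
          have h3 := mul_le_mul_of_nonneg_left (hvw m hkm hmn) hcm
          have h4 := mul_le_mul_of_nonneg_right hqm (sub_nonneg.2 hvp)
          refine le_of_mul_le_mul_right ?_ hpos
          linarith
      linarith
  have := main n hkn le_rfl
  have h := mul_nonneg (hc n hkn le_rfl) (hw n hkn le_rfl)
  linarith

section Measure

variable {Ω : Type*} [MeasurableSpace Ω] {P : Measure Ω} [IsProbabilityMeasure P] {n k : ℕ}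
  {E : ℕ → Fin n → Set Ω}

theorem measurable_occurrences {ι : Type*} {E : ι → Set Ω} {t : Finset ι}
    (hE : ∀ i ∈ t, MeasurableSet (E i)) : Measurable (occurrences E t) := by
  simp only [funext (occurrences_eq_sum E t)]
  exact Finset.measurable_fun_sum _ fun i hi => measurable_const.indicator (hE i hi)

/-- Measurability is asked only for i ∈ t, so that the lemma also applies to the σ-algebra generated
by the variables in `t`. -/
theorem measurableSet_stepUpEvent {t : Finset (Fin n)}
    (hE : ∀ j, ∀ i ∈ t, MeasurableSet (E j i)) (m l : ℕ) : MeasurableSet (stepUpEvent E t m l) := by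
  have : stepUpEvent E t m l =
      ⋃ j, ⋃ (_ : l ≤ j), ⋃ (_ : j ≤ n), {ω | j ≤ m + occurrences (E j) t ω} := by
    ext ω
    simp only [stepUpEvent, Set.mem_ofPred_eq, Set.mem_iUnion, exists_prop]
  rw [this]
  refine .iUnion fun j => .iUnion fun _ => .iUnion fun _ => ?_
  exact measurableSet_le measurable_const (measurable_const.add (measurable_occurrences (hE j)))

/-- Counting the `k`-subsets of the `j` events that occur on a given event. -/
theorem choose_mul_measureReal_eq_sum {E : Fin n → Set Ω} (hE : ∀ i, MeasurableSet (E i))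
    {D : Set Ω} (hD : MeasurableSet D) {j : ℕ}
    (hj : ∀ ω ∈ D, occurrences E Finset.univ ω = j) :
    (j.choose k : ℝ) * P.real D
      = ∑ s ∈ (Finset.univ : Finset (Fin n)).powersetCard k, P.real ((⋂ i ∈ s, E i) ∩ D) := by
  classical
  have hA : ∀ s : Finset (Fin n), MeasurableSet ((⋂ i ∈ s, E i) ∩ D) := fun s =>
    (Finset.measurableSet_biInter s fun i _ => hE i).inter hD
  -- Integrate the sum of the indicators: at each point of `D` it counts the k-subsets of a j-set.
  have key : ∑ s ∈ (Finset.univ : Finset (Fin n)).powersetCard k, P ((⋂ i ∈ s, E i) ∩ D)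
      = (j.choose k : ℝ≥0∞) * P D := by
    simp_rw [← fun s => lintegral_indicator_one (μ := P) (hA s)]
    rw [← lintegral_finsetSum _ fun s _ => measurable_one.indicator (hA s),
      ← lintegral_indicator_const hD]
    congr 1
    ext ω
    by_cases hω : ω ∈ D
    · have : (Finset.univ.powersetCard k).filter (fun s => ω ∈ ⋂ i ∈ s, E i)
          = (Finset.univ.filter fun i => ω ∈ E i).powersetCard k := by
        ext s
        simp [Finset.mem_powersetCard, Finset.subset_iff, and_comm]
      simp only [Set.indicator_apply, Set.mem_inter_iff, hω, and_true, if_true, Pi.one_apply,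
        Finset.sum_boole]
      rw [this, Finset.card_powersetCard, ← hj ω hω]
      rfl
    · simp [hω]
  simp only [measureReal_def]
  rw [← ENNReal.toReal_sum fun s _ => measure_ne_top _ _, key]
  simp

/-- Split by the last level j that qualifies, count k-subsets of the j occurring events, and use
that on ⋂ i ∈ s, E j i only the events outside `s` remain undecided from level j on. -/
theorem measureReal_stepUpEvent_eq (hkn : k ≤ n) (hEm : ∀ j i, MeasurableSet (E j i))
    (hE : ∀ i, MonotoneOn (fun j => E j i) (Set.Icc k n)) :
    P.real (stepUpEvent E Finset.univ 0 k)
      = ∑ s ∈ (Finset.univ : Finset (Fin n)).powersetCard k, ∑ j ∈ Finset.Ico k (n + 1),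
          (j.choose k : ℝ)⁻¹ *
            P.real ((⋂ i ∈ s, E j i) ∩ (stepUpEvent E sᶜ k j \ stepUpEvent E sᶜ k (j + 1))) := by
  set B := stepUpEvent E Finset.univ 0 with hB
  have hBm : ∀ l, MeasurableSet (B l) := measurableSet_stepUpEvent (fun j i _ => hEm j i) _
  have tel : P.real (B k) = ∑ j ∈ Finset.Ico k (n + 1), P.real (B j \ B (j + 1)) := by
    have aux : ∀ m, k ≤ m →
        ∑ j ∈ Finset.Ico k m, P.real (B j \ B (j + 1)) = P.real (B k) - P.real (B m) := by
      intro m hm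
      induction m, hm using Nat.le_induction with
      | base => simp
      | succ m hm ih =>
        rw [Finset.sum_Ico_succ_top hm, ih,
          measureReal_sdiff (stepUpEvent_anti E _ _ (Nat.le_succ m)) (hBm _)]
        ring
    rw [aux (n + 1) (by omega), hB, stepUpEvent_eq_empty E _ 0 (Nat.lt_succ_self n)]
    simp
  rw [tel, Finset.sum_comm]
  refine Finset.sum_congr rfl fun j hj => ?_
  obtain ⟨hkj, hjn⟩ := Finset.mem_Ico.1 hj
  have hpos : (0 : ℝ) < j.choose k := by exact_mod_cast Nat.choose_pos hkj
  rw [← Finset.mul_sum, eq_inv_mul_iff_mul_eq₀ hpos.ne',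
    choose_mul_measureReal_eq_sum (k := k) (hEm j) ((hBm j).diff (hBm (j + 1))) fun ω hω =>
      occurrences_eq_of_mem_stepUpEvent_diff hE hkj hω.1 hω.2]
  refine Finset.sum_congr rfl fun s hs => ?_
  congr 1
  ext ω
  refine and_congr_right fun hω => ?_
  have hs := (Finset.mem_powersetCard.1 hs).2
  exact and_congr (mem_stepUpEvent_univ_iff hE hs hkj le_rfl hω)
    (not_congr (mem_stepUpEvent_univ_iff hE hs hkj (Nat.le_succ j) hω))

/-- The generalized Simes inequality for positively dependent families of events. -/
theorem measureReal_stepUpEvent_le (hkn : k ≤ n) (hEm : ∀ j i, MeasurableSet (E j i))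
    (hE : ∀ i, MonotoneOn (fun j => E j i) (Set.Icc k n)) {p : ℕ → ℝ}
    (hp : ∀ s : Finset (Fin n), s.card = k → ∀ j ∈ Set.Icc k n, P.real (⋂ i ∈ s, E j i) = p j)
    (hdep : ∀ s : Finset (Fin n), s.card = k → ∀ j, k ≤ j → j < n →
      P (stepUpEvent E sᶜ k (j + 1) ∩ ⋂ i ∈ s, E (j + 1) i) * P (⋂ i ∈ s, E j i)
        ≤ P (stepUpEvent E sᶜ k (j + 1) ∩ ⋂ i ∈ s, E j i) * P (⋂ i ∈ s, E (j + 1) i))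
    (hq : MonotoneOn (fun j => p j / (j.choose k : ℝ)) (Set.Icc k n)) :
    P.real (stepUpEvent E Finset.univ 0 k) ≤ p n := by
  have hAm : ∀ (s : Finset (Fin n)) j, MeasurableSet (⋂ i ∈ s, E j i) := fun s j =>
    Finset.measurableSet_biInter s fun i _ => hEm j i
  have bound : ∀ s ∈ (Finset.univ : Finset (Fin n)).powersetCard k,
      ∑ j ∈ Finset.Ico k (n + 1), (j.choose k : ℝ)⁻¹ *
        P.real ((⋂ i ∈ s, E j i) ∩ (stepUpEvent E sᶜ k j \ stepUpEvent E sᶜ k (j + 1)))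
          ≤ (n.choose k : ℝ)⁻¹ * p n := by
    intro s hs
    have hs := (Finset.mem_powersetCard.1 hs).2
    have split : ∀ j, P.real
        ((⋂ i ∈ s, E j i) ∩ (stepUpEvent E sᶜ k j \ stepUpEvent E sᶜ k (j + 1)))
        = P.real (stepUpEvent E sᶜ k j ∩ ⋂ i ∈ s, E j i)
          - P.real (stepUpEvent E sᶜ k (j + 1) ∩ ⋂ i ∈ s, E j i) := by
      intro j
      rw [← measureReal_sdiff
        (Set.inter_subset_inter_left _ (stepUpEvent_anti E _ _ (Nat.le_succ j)))
        ((measurableSet_stepUpEvent (fun j i _ => hEm j i) _ _).inter (hAm s j))]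
      congr 1
      ext ω
      simp only [Set.mem_inter_iff, Set.mem_sdiff]
      tauto
    simp only [split]
    refine sum_mul_sub_le_of_monotoneOn hkn (fun j _ _ => by positivity)
      (v := fun j => P.real (stepUpEvent E sᶜ k j ∩ ⋂ i ∈ s, E j i))
      (w := fun j => P.real (stepUpEvent E sᶜ k (j + 1) ∩ ⋂ i ∈ s, E j i)) ?_
      (fun j _ _ => measureReal_nonneg) ?_ ?_ ?_
    · intro j h₁ h₂
      rw [← hp s hs j ⟨h₁, h₂⟩]
      exact measureReal_mono Set.inter_subset_right
    · intro j h₁ h₂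
      rw [← hp s hs j ⟨h₁, h₂.le⟩, ← hp s hs (j + 1) ⟨by omega, h₂⟩]
      simp only [measureReal_def, ← ENNReal.toReal_mul]
      exact ENNReal.toReal_mono (by finiteness) (hdep s hs j h₁ h₂)
    · intro j h₁ h₂
      have hle : p j ≤ p (j + 1) := by
        rw [← hp s hs j ⟨h₁, h₂.le⟩, ← hp s hs (j + 1) ⟨by omega, h₂⟩]
        exact measureReal_mono (Set.iInter₂_mono fun i _ =>
          hE i ⟨h₁, h₂.le⟩ ⟨by omega, h₂⟩ (Nat.le_succ j))
      have h0 : 0 ≤ p j := by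
        rw [← hp s hs j ⟨h₁, h₂.le⟩]
        exact measureReal_nonneg
      rcases h0.eq_or_lt with h | h
      · exact .inl h.symm
      · exact .inr (h.trans_le hle)
    · simpa only [div_eq_inv_mul] using hq
  rw [measureReal_stepUpEvent_eq hkn hEm hE]
  refine (Finset.sum_le_sum bound).trans_eq ?_
  have hpos : (0 : ℝ) < n.choose k := by exact_mod_cast Nat.choose_pos hkn
  simp only [Finset.sum_const, Finset.card_powersetCard, Finset.card_univ, Fintype.card_fin,
    nsmul_eq_mul]
  field_simp

/-- The case of equality in the generalized Simes inequality. -/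
theorem measureReal_stepUpEvent_eq_of_indep (hkn : k ≤ n) (hEm : ∀ j i, MeasurableSet (E j i))
    (hE : ∀ i, MonotoneOn (fun j => E j i) (Set.Icc k n)) {p : ℕ → ℝ}
    (hp : ∀ s : Finset (Fin n), s.card = k → ∀ j ∈ Set.Icc k n, P.real (⋂ i ∈ s, E j i) = p j)
    (hindep : ∀ (s : Finset (Fin n)) (j l : ℕ),
      P.real ((⋂ i ∈ s, E j i) ∩ stepUpEvent E sᶜ k l)
        = P.real (⋂ i ∈ s, E j i) * P.real (stepUpEvent E sᶜ k l))
    {q : ℝ} (hq : ∀ j ∈ Set.Icc k n, p j / (j.choose k : ℝ) = q) :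
    P.real (stepUpEvent E Finset.univ 0 k) = p n := by
  have hAm : ∀ (s : Finset (Fin n)) j, MeasurableSet (⋂ i ∈ s, E j i) := fun s j =>
    Finset.measurableSet_biInter s fun i _ => hEm j i
  have each : ∀ s ∈ (Finset.univ : Finset (Fin n)).powersetCard k,
      ∑ j ∈ Finset.Ico k (n + 1), (j.choose k : ℝ)⁻¹ *
        P.real ((⋂ i ∈ s, E j i) ∩ (stepUpEvent E sᶜ k j \ stepUpEvent E sᶜ k (j + 1))) = q := by
    intro s hs
    have hs := (Finset.mem_powersetCard.1 hs).2
    -- Independence factors out p j / C(j,k) = q, leaving a telescoping sum that starts from the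
    -- sure event at level k and ends with the empty one at level n + 1.
    have aux : ∀ m, k ≤ m → m ≤ n + 1 → ∑ j ∈ Finset.Ico k m, (j.choose k : ℝ)⁻¹ *
        P.real ((⋂ i ∈ s, E j i) ∩ (stepUpEvent E sᶜ k j \ stepUpEvent E sᶜ k (j + 1)))
          = q * (1 - P.real (stepUpEvent E sᶜ k m)) := by
      intro m hm
      induction m, hm using Nat.le_induction with
      | base => simp [stepUpEvent_self_eq_univ E _ hkn]
      | succ m hm ih =>
        intro hmn
        have hL := measurableSet_stepUpEvent (t := sᶜ) (fun j i _ => hEm j i) k (m + 1)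
        rw [Finset.sum_Ico_succ_top hm, ih (by omega), Set.inter_sdiff_distrib_left,
          measureReal_sdiff
            (Set.inter_subset_inter_right _ (stepUpEvent_anti E _ _ (Nat.le_succ m)))
            ((hAm s m).inter hL), hindep, hindep, hp s hs m ⟨hm, by omega⟩,
          ← hq m ⟨hm, by omega⟩]
        ring
    rw [aux (n + 1) (by omega) le_rfl, stepUpEvent_eq_empty E _ k (Nat.lt_succ_self n)]
    simp
  rw [measureReal_stepUpEvent_eq hkn hEm hE, Finset.sum_congr rfl each, ← hq n ⟨hkn, le_rfl⟩]
  have hpos : (0 : ℝ) < n.choose k := by exact_mod_cast Nat.choose_pos hkn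
  simp only [Finset.sum_const, Finset.card_powersetCard, Finset.card_univ, Fintype.card_fin,
    nsmul_eq_mul]
  field_simp

end Measure

/-! ### Order statistics through counts. -/

section OrderStatistics

variable {n : ℕ} (x : Fin n → ℝ) (a : ℝ) (i : Fin n)

open Classical in
theorem orderStat_lt_iff :
    orderStat x i < a ↔ (i : ℕ) < (Finset.univ.filter fun l => x l < a).card := by
  rw [← Finset.card_equiv (s := Finset.univ.filter fun l => x (Tuple.sort x l) < a)
    (Tuple.sort x) (by simp)]
  exact (Tuple.lt_card_lt_iff_apply_lt_of_monotone (Tuple.monotone_sort x)).symm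

open Classical in
theorem orderStat_le_iff :
    orderStat x i ≤ a ↔ (i : ℕ) < (Finset.univ.filter fun l => x l ≤ a).card := by
  rw [← Finset.card_equiv (s := Finset.univ.filter fun l => x (Tuple.sort x l) ≤ a)
    (Tuple.sort x) (by simp)]
  exact (Tuple.lt_card_le_iff_apply_le_of_monotone (Tuple.monotone_sort x)).symm

open Classical in
theorem lt_orderStat_iff :
    a < orderStat x i ↔ n ≤ i + (Finset.univ.filter fun l => a < x l).card := by
  rw [← not_le, orderStat_le_iff]
  have := Finset.card_filter_add_card_filter_not (s := (Finset.univ : Finset (Fin n)))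
    (fun l => x l ≤ a)
  simp only [not_le, Finset.card_univ, Fintype.card_fin] at this
  omega

end OrderStatistics

/-! ### Symmetric, MTP₂ and independent laws. -/

section Laws

variable {Ω : Type*} {n k : ℕ} {X : Fin n → Ω → ℝ}

theorem setOf_forall_le_orderStat_eq (a : ℕ → ℝ) (hk : 1 ≤ k) :
    {ω | ∀ i : Fin n, k ≤ (i : ℕ) + 1 → a ((i : ℕ) + 1) ≤ orderStat (fun l => X l ω) i}
      = (stepUpEvent (fun j i => X i ⁻¹' Set.Iio (a j)) Finset.univ 0 k)ᶜ := by
  classical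
  ext ω
  simp only [Set.mem_ofPred_eq, Set.mem_compl_iff, stepUpEvent, occurrences, Set.mem_preimage,
    Set.mem_Iio, zero_add]
  constructor
  · rintro h ⟨j, h₁, h₂, h₃⟩
    have := h ⟨j - 1, by omega⟩ (by simp; omega)
    rw [← not_lt, orderStat_lt_iff] at this
    simp only [Nat.sub_add_cancel (hk.trans h₁)] at this
    refine this (lt_of_lt_of_le (by omega : j - 1 < j) (h₃.trans_eq ?_))
    congr
  · intro h i hi
    rw [← not_lt, orderStat_lt_iff]
    refine fun hlt => h ⟨i + 1, hi, i.2, Nat.succ_le_of_lt (hlt.trans_eq ?_)⟩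
    congr

/-- The bound at rank n - j + 1 fails exactly when at least j variables exceed b (n - j + 1), so
level j is paired with that index. -/
theorem setOf_forall_orderStat_le_eq (b : ℕ → ℝ) (hk : 1 ≤ k) (hkn : k ≤ n) :
    {ω | ∀ i : Fin n, (i : ℕ) + 1 ≤ n - k + 1 →
        orderStat (fun l => X l ω) i ≤ b ((i : ℕ) + 1)}
      = (stepUpEvent (fun j i => X i ⁻¹' Set.Ioi (b (n - j + 1))) Finset.univ 0 k)ᶜ := by
  classical
  ext ω
  simp only [Set.mem_ofPred_eq, Set.mem_compl_iff, stepUpEvent, occurrences, Set.mem_preimage,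
    Set.mem_Ioi, zero_add]
  constructor
  · rintro h ⟨j, h₁, h₂, h₃⟩
    have := h ⟨n - j, by omega⟩ (by simp; omega)
    rw [← not_lt, lt_orderStat_iff] at this
    refine this ?_
    simp only
    have h₄ := h₃.trans_eq (b := _) (c := (Finset.univ.filter fun l =>
      b (n - j + 1) < X l ω).card) (by congr)
    omega
  · intro h i hi
    rw [← not_lt, lt_orderStat_iff]
    refine fun hlt => h ⟨n - i, by omega, by omega, ?_⟩
    rw [show n - (n - (i : ℕ)) + 1 = i + 1 by omega]
    have : n - i ≤ (Finset.univ.filter fun l => b (i + 1) < X l ω).card := by omega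
    exact this.trans_eq (by congr)

variable [MeasurableSpace Ω] {P : Measure Ω}

theorem maxCDF_eq [IsProbabilityMeasure P] (hX : ∀ i, Measurable (X i)) (s : Finset (Fin n))
    (hs : s.Nonempty) (x : ℝ) :
    maxCDF P X s hs x = P.real (⋂ i ∈ s, X i ⁻¹' Set.Iic x) := by
  have hm : Measurable fun ω => s.sup' hs fun i => X i ω := by
    convert! Finset.measurable_sup' hs fun i _ => hX i using 1
    ext ω
    simp
  have := Measure.isProbabilityMeasure_map (μ := P) hm.aemeasurable
  rw [maxCDF, cdf_eq_real, map_measureReal_apply hm measurableSet_Iic]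
  congr 1
  ext ω
  simp

theorem one_sub_minCDF_eq [IsProbabilityMeasure P] (hX : ∀ i, Measurable (X i))
    (s : Finset (Fin n)) (hs : s.Nonempty) (x : ℝ) :
    1 - minCDF P X s hs x = P.real (⋂ i ∈ s, X i ⁻¹' Set.Ioi x) := by
  have hm : Measurable fun ω => s.inf' hs fun i => X i ω := by
    convert! Finset.inf'_induction hs X (p := fun g => Measurable g)
      (fun _ h₁ _ h₂ => h₁.inf h₂) (fun i _ => hX i) using 1
    ext ω
    simp
  have := Measure.isProbabilityMeasure_map (μ := P) hm.aemeasurable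
  rw [minCDF, cdf_eq_real, ← probReal_compl_eq_one_sub measurableSet_Iic,
    map_measureReal_apply hm measurableSet_Iic.compl]
  congr 1
  ext ω
  simp

/-- Under a symmetric law the probability that the variables indexed by `s` lie in `C` depends
only on the cardinality of `s`. -/
theorem IsSymmetricLaw.measureReal_biInter_preimage_eq (hX : ∀ i, Measurable (X i))
    (h : IsSymmetricLaw (P.map fun ω i => X i ω)) {s t : Finset (Fin n)} (hst : s.card = t.card)
    {C : Set ℝ} (hC : MeasurableSet C) :
    P.real (⋂ i ∈ s, X i ⁻¹' C) = P.real (⋂ i ∈ t, X i ⁻¹' C) := by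
  obtain ⟨σ, hσ⟩ := Equiv.Perm.exists_map_finset_eq s t hst
  have hXm : Measurable fun ω i => X i ω := measurable_pi_iff.2 hX
  have hm : ∀ u : Finset (Fin n), MeasurableSet (⋂ i ∈ u, (fun x : Fin n → ℝ => x i) ⁻¹' C) :=
    fun u => Finset.measurableSet_biInter u fun i _ => measurable_pi_apply i hC
  have e := congrArg (fun μ => μ.real (⋂ i ∈ s, (fun x : Fin n → ℝ => x i) ⁻¹' C)) (h σ)
  rw [map_measureReal_apply (by fun_prop) (hm s), map_measureReal_apply hXm (hm s),
    map_measureReal_apply hXm (by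
      exact (show Measurable fun (x : Fin n → ℝ) i => x (σ i) by fun_prop) (hm s))] at e
  rw [← hσ]
  convert e.symm using 2
  · ext ω; simp
  · ext ω
    simp only [Set.mem_iInter, Finset.mem_map_equiv, Set.mem_preimage]
    exact ⟨fun h i hi => h (σ i) (by simpa), fun h i hi => by simpa using h _ hi⟩

/-- In conditional form: given that the variables of `s` lie in the larger set `C (j + 1)`, the
step-up event is no likelier than given that they lie in `C j`. -/
theorem IsMTP2.stepUpEvent_inter_mul_le (hX : ∀ i, Measurable (X i))
    (h : IsMTP2 (P.map fun ω i => X i ω)) {C : ℕ → Set ℝ} (hCm : ∀ j, MeasurableSet (C j))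
    (hC : (∀ j, IsLowerSet (C j)) ∨ ∀ j, IsUpperSet (C j)) {j : ℕ} (hj : C j ⊆ C (j + 1))
    (s t : Finset (Fin n)) (m l : ℕ) :
    P (stepUpEvent (fun j i => X i ⁻¹' C j) t m l ∩ ⋂ i ∈ s, X i ⁻¹' C (j + 1))
        * P (⋂ i ∈ s, X i ⁻¹' C j)
      ≤ P (stepUpEvent (fun j i => X i ⁻¹' C j) t m l ∩ ⋂ i ∈ s, X i ⁻¹' C j)
        * P (⋂ i ∈ s, X i ⁻¹' C (j + 1)) := by
  have hXm : Measurable fun ω i => X i ω := measurable_pi_iff.2 hX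
  set A : ℕ → Set (Fin n → ℝ) := fun j => ⋂ i ∈ s, (fun x => x i) ⁻¹' C j with hA
  set L : Set (Fin n → ℝ) := stepUpEvent (fun j i => (fun x => x i) ⁻¹' C j) t m l with hL
  have hAm : ∀ j, MeasurableSet (A j) := fun j =>
    Finset.measurableSet_biInter s fun i _ => measurable_pi_apply i (hCm j)
  have hLm : MeasurableSet L :=
    measurableSet_stepUpEvent (fun j i _ => measurable_pi_apply i (hCm j)) _ _
  have hAX : ∀ j, ⋂ i ∈ s, X i ⁻¹' C j = (fun ω i => X i ω) ⁻¹' A j := fun j => by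
    ext ω; simp [hA]
  have hLX : stepUpEvent (fun j i => X i ⁻¹' C j) t m l = (fun ω i => X i ω) ⁻¹' L := rfl
  have hLmono : ∀ x y : Fin n → ℝ, (∀ j i, x i ∈ C j → y i ∈ C j) → x ∈ L → y ∈ L := by
    rintro x y hxy ⟨j, h₁, h₂, h₃⟩
    exact ⟨j, h₁, h₂, h₃.trans (Nat.add_le_add_left
      (occurrences_mono t fun i _ hi => hxy j i hi) m)⟩
  have hAj : A j ⊆ A (j + 1) := Set.iInter₂_mono fun i _ => Set.preimage_mono hj
  simp only [hAX, hLX, ← Set.preimage_inter]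
  simp only [← Measure.map_apply hXm (hLm.inter (hAm _)), ← Measure.map_apply hXm (hAm _)]
  -- Each coordinate of x ⊔ y is one of the two, so no order property of `C` is needed.
  have sup_mem : ∀ x ∈ A (j + 1), ∀ y ∈ A (j + 1), x ⊔ y ∈ A (j + 1) := by
    intro x hx y hy
    simp only [hA, Set.mem_iInter] at hx hy ⊢
    intro i hi
    rcases max_choice (x i) (y i) with e | e
    · simpa [e] using hx i hi
    · simpa [e] using hy i hi
  have inf_mem : ∀ x ∈ A (j + 1), ∀ y ∈ A (j + 1), x ⊓ y ∈ A (j + 1) := by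
    intro x hx y hy
    simp only [hA, Set.mem_iInter] at hx hy ⊢
    intro i hi
    rcases min_choice (x i) (y i) with e | e
    · simpa [e] using hx i hi
    · simpa [e] using hy i hi
  -- For lower sets x ⊓ y inherits both `L` and `A j`; for upper sets x ⊔ y does, so the two target
  -- events swap roles.
  rcases hC with hC | hC
  · rw [mul_comm (P.map _ (L ∩ A j))]
    refine h.measure_mul_measure_le (hLm.inter (hAm _)) (hAm _) (hAm _) (hLm.inter (hAm _))
      (fun x hx y hy => sup_mem x hx.2 y (hAj hy)) fun x hx y hy => ⟨?_, ?_⟩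
    · exact hLmono x _ (fun j i hi => hC j (by simp) hi) hx.1
    · simp only [hA, Set.mem_iInter] at hy ⊢
      exact fun i hi => hC j (by simp) (hy i hi)
  · refine h.measure_mul_measure_le (hLm.inter (hAm _)) (hAm _) (hLm.inter (hAm _)) (hAm _)
      (fun x hx y hy => ⟨?_, ?_⟩) (fun x hx y hy => inf_mem x hx.2 y (hAj hy))
    · exact hLmono x _ (fun j i hi => hC j (by simp) hi) hx.1
    · simp only [hA, Set.mem_iInter] at hy ⊢
      exact fun i hi => hC j (by simp) (hy i hi)

/-- The two events belong to the σ-algebras generated by the variables in `s` and in `sᶜ`, which are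
independent. -/
theorem measureReal_biInter_inter_stepUpEvent_of_iIndepFun (hX : ∀ i, Measurable (X i))
    (h : iIndepFun X P) {C : ℕ → Set ℝ} (hCm : ∀ j, MeasurableSet (C j)) (s : Finset (Fin n))
    (j m l : ℕ) :
    P.real ((⋂ i ∈ s, X i ⁻¹' C j) ∩ stepUpEvent (fun j i => X i ⁻¹' C j) sᶜ m l)
      = P.real (⋂ i ∈ s, X i ⁻¹' C j)
        * P.real (stepUpEvent (fun j i => X i ⁻¹' C j) sᶜ m l) := by
  have hind := indep_iSup_of_disjoint (fun i => (hX i).comap_le) h.iIndep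
    (S := (s : Set (Fin n))) (T := ((sᶜ : Finset (Fin n)) : Set (Fin n)))
    (Finset.disjoint_coe.2 disjoint_compl_right)
  have hmem : ∀ (t : Finset (Fin n)) (j : ℕ), ∀ i ∈ t, MeasurableSet[⨆ i ∈ (t : Set (Fin n)),
      MeasurableSpace.comap (X i) inferInstance] (X i ⁻¹' C j) := fun t j i hi =>
    le_iSup₂ (f := fun i (_ : i ∈ (t : Set (Fin n))) =>
      MeasurableSpace.comap (X i) inferInstance) i hi _ ⟨C j, hCm j, rfl⟩
  simp only [measureReal_def]
  rw [(Indep_iff _ _ _).1 hind _ _ (Finset.measurableSet_biInter s (hmem s j))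
    (@measurableSet_stepUpEvent Ω (_) n _ sᶜ (hmem sᶜ) m l), ENNReal.toReal_mul]

theorem measure_singleton_eq_zero_of_continuous_cdf {μ : Measure ℝ} [IsProbabilityMeasure μ]
    (h : Continuous (cdf μ)) (x : ℝ) : μ {x} = 0 := by
  rw [← measure_cdf μ, StieltjesFunction.measure_singleton,
    (h.continuousAt (x := x)).continuousWithinAt.leftLim_eq]
  simp

theorem measureReal_biInter_Iio_eq [IsProbabilityMeasure P] (hX : ∀ i, Measurable (X i))
    (hcont : ∀ i, Continuous (cdf (P.map (X i)))) (s : Finset (Fin n)) (x : ℝ) :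
    P.real (⋂ i ∈ s, X i ⁻¹' Set.Iio x) = P.real (⋂ i ∈ s, X i ⁻¹' Set.Iic x) := by
  refine measureReal_congr ?_
  have hne : ∀ᵐ ω ∂P, ∀ i, X i ω ≠ x := by
    refine ae_all_iff.2 fun i => ?_
    have := Measure.isProbabilityMeasure_map (μ := P) (hX i).aemeasurable
    have h0 := measure_singleton_eq_zero_of_continuous_cdf (hcont i) x
    rw [Measure.map_apply (hX i) (measurableSet_singleton x)] at h0
    exact measure_eq_zero_iff_ae_notMem.1 h0
  filter_upwards [hne] with ω hω
  refine propext ?_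
  change (ω ∈ ⋂ i ∈ s, X i ⁻¹' Set.Iio x) ↔ ω ∈ ⋂ i ∈ s, X i ⁻¹' Set.Iic x
  simp only [Set.mem_iInter, Set.mem_preimage, Set.mem_Iio, Set.mem_Iic, lt_iff_le_and_ne]
  exact ⟨fun h i hi => (h i hi).1, fun h i hi => ⟨h i hi, hω i⟩⟩

end Laws

/-! ### The generalized Simes inequalities. -/

theorem corollary2p1 {Ω : Type*} [MeasurableSpace Ω] (P : Measure Ω) [IsProbabilityMeasure P]
    (n k : ℕ) (hk : 1 ≤ k) (hkn : k ≤ n)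
    (X : Fin n → Ω → ℝ) (hX : ∀ i, Measurable (X i))
    (hsymm : IsSymmetricLaw (P.map (fun ω i => X i ω)))
    (hMTP2 : IsMTP2 (P.map (fun ω i => X i ω))) :
    -- the maxima (the minima) of any `k` of the variables have a common cdf
    (∃ F G : ℝ → ℝ,
      (∀ (s : Finset (Fin n)) (hs : s.Nonempty), s.card = k →
        maxCDF P X s hs = F ∧ minCDF P X s hs = G) ∧
      -- (a)
      (∀ a : ℕ → ℝ, MonotoneOn a (Set.Icc k n) →
        (MonotoneOn (fun j : ℕ => F (a j) / (j.choose k : ℝ)) (Set.Icc k n) →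
          1 - F (a n) ≤
            P.real {ω | ∀ i : Fin n, k ≤ (i : ℕ) + 1 →
              a ((i : ℕ) + 1) ≤ orderStat (fun l => X l ω) i}) ∧
        ((∀ i, Continuous (cdf (P.map (X i)))) → iIndepFun X P →
          (∃ c : ℝ, ∀ j ∈ Set.Icc k n, F (a j) / (j.choose k : ℝ) = c) →
          P.real {ω | ∀ i : Fin n, k ≤ (i : ℕ) + 1 →
              a ((i : ℕ) + 1) ≤ orderStat (fun l => X l ω) i} = 1 - F (a n))) ∧
      -- (b)
      (∀ b : ℕ → ℝ, MonotoneOn b (Set.Icc 1 (n - k + 1)) →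
        (MonotoneOn (fun j : ℕ => (1 - G (b (n - j + 1))) / (j.choose k : ℝ)) (Set.Icc k n) →
          G (b 1) ≤
            P.real {ω | ∀ i : Fin n, (i : ℕ) + 1 ≤ n - k + 1 →
              orderStat (fun l => X l ω) i ≤ b ((i : ℕ) + 1)}) ∧
        (iIndepFun X P →
          (∃ c : ℝ, ∀ j ∈ Set.Icc k n, (1 - G (b (n - j + 1))) / (j.choose k : ℝ) = c) →
          P.real {ω | ∀ i : Fin n, (i : ℕ) + 1 ≤ n - k + 1 →
              orderStat (fun l => X l ω) i ≤ b ((i : ℕ) + 1)} = G (b 1)))) := by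
  obtain ⟨s₀, -, hs₀⟩ := Finset.exists_subset_card_eq (s := (Finset.univ : Finset (Fin n)))
    (n := k) (by simpa using hkn)
  have hne : s₀.Nonempty := Finset.card_pos.1 (by omega)
  have hF : ∀ (s : Finset (Fin n)) x, s.card = k →
      P.real (⋂ i ∈ s, X i ⁻¹' Set.Iic x) = maxCDF P X s₀ hne x := fun s x hs => by
    rw [maxCDF_eq hX]
    exact hsymm.measureReal_biInter_preimage_eq hX (hs.trans hs₀.symm) measurableSet_Iic
  have hG : ∀ (s : Finset (Fin n)) x, s.card = k →
      P.real (⋂ i ∈ s, X i ⁻¹' Set.Ioi x) = 1 - minCDF P X s₀ hne x := fun s x hs => by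
    rw [one_sub_minCDF_eq hX]
    exact hsymm.measureReal_biInter_preimage_eq hX (hs.trans hs₀.symm) measurableSet_Ioi
  have hIio : ∀ (a : ℕ → ℝ) j i, MeasurableSet (X i ⁻¹' Set.Iio (a j)) :=
    fun a j i => hX i measurableSet_Iio
  have hIic : ∀ (a : ℕ → ℝ) j i, MeasurableSet (X i ⁻¹' Set.Iic (a j)) :=
    fun a j i => hX i measurableSet_Iic
  have hIoi : ∀ (a : ℕ → ℝ) j i, MeasurableSet (X i ⁻¹' Set.Ioi (a j)) :=
    fun a j i => hX i measurableSet_Ioi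
  refine ⟨maxCDF P X s₀ hne, minCDF P X s₀ hne, fun s hs hsk => ⟨?_, ?_⟩, fun a ha => ⟨?_, ?_⟩,
    fun b hb => ?_⟩
  · ext x
    rw [← hF s x hsk, maxCDF_eq hX]
  · ext x
    have := hG s x hsk
    rw [← one_sub_minCDF_eq hX s hs] at this
    linarith
  · intro hq
    rw [setOf_forall_le_orderStat_eq a hk, probReal_compl_eq_one_sub
      (measurableSet_stepUpEvent (fun j i _ => hIio a j i) _ _)]
    -- The failure event involves X_i < a_j while F records X_i ≤ a_j. Passing to the weak
    -- inequality only enlarges it; for equality, continuity of the marginals removes the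
    -- difference.
    have hmono : stepUpEvent (fun j i => X i ⁻¹' Set.Iio (a j)) Finset.univ 0 k
        ⊆ stepUpEvent (fun j i => X i ⁻¹' Set.Iic (a j)) Finset.univ 0 k := by
      rintro ω ⟨j, h₁, h₂, h₃⟩
      exact ⟨j, h₁, h₂, h₃.trans (Nat.add_le_add_left
        (occurrences_mono _ fun i _ hi => Set.preimage_mono Set.Iio_subset_Iic_self hi) 0)⟩
    have hle := measureReal_stepUpEvent_le (P := P) hkn (hIic a)
      (fun i j hj l hl hjl => Set.preimage_mono (Set.Iic_subset_Iic.2 (ha hj hl hjl)))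
      (p := fun j => maxCDF P X s₀ hne (a j)) (fun s hs j _ => hF s (a j) hs)
      (fun s _ j h₁ h₂ => hMTP2.stepUpEvent_inter_mul_le hX (C := fun j => Set.Iic (a j))
        (fun _ => measurableSet_Iic) (.inl fun _ => isLowerSet_Iic _)
        (Set.Iic_subset_Iic.2 (ha ⟨h₁, h₂.le⟩ ⟨by omega, h₂⟩ (Nat.le_succ j))) _ _ _ _) hq
    have := measureReal_mono (μ := P) hmono
    linarith
  · rintro hcont hind ⟨c, hc⟩
    rw [setOf_forall_le_orderStat_eq a hk, probReal_compl_eq_one_sub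
      (measurableSet_stepUpEvent (fun j i _ => hIio a j i) _ _),
      measureReal_stepUpEvent_eq_of_indep hkn (hIio a)
        (fun i j hj l hl hjl => Set.preimage_mono (Set.Iio_subset_Iio (ha hj hl hjl)))
        (p := fun j => maxCDF P X s₀ hne (a j))
        (fun s hs j _ => (measureReal_biInter_Iio_eq hX hcont s (a j)).trans (hF s (a j) hs))
        (fun s j l => measureReal_biInter_inter_stepUpEvent_of_iIndepFun hX hind
          (C := fun j => Set.Iio (a j)) (fun _ => measurableSet_Iio) s j k l) hc]
  -- Here 1 - G is already the probability of strict exceedance, so no continuity is needed. The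
  -- index reversal n - j + 1 makes the half-lines grow with j.
  · have hCmono : ∀ j ∈ Set.Icc k n, ∀ l ∈ Set.Icc k n, j ≤ l →
        Set.Ioi (b (n - j + 1)) ⊆ Set.Ioi (b (n - l + 1)) := by
      rintro j ⟨h₁, h₂⟩ l ⟨h₃, h₄⟩ hjl
      exact Set.Ioi_subset_Ioi (hb ⟨by omega, by omega⟩ ⟨by omega, by omega⟩ (by omega))
    rw [setOf_forall_orderStat_le_eq b hk hkn, probReal_compl_eq_one_sub
      (measurableSet_stepUpEvent (fun j i _ => hIoi (fun j => b (n - j + 1)) j i) _ _)]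
    constructor
    · intro hq
      have hle := measureReal_stepUpEvent_le (P := P) hkn (hIoi fun j => b (n - j + 1))
        (fun i j hj l hl hjl => Set.preimage_mono (hCmono j hj l hl hjl))
        (p := fun j => 1 - minCDF P X s₀ hne (b (n - j + 1))) (fun s hs j _ => hG s _ hs)
        (fun s _ j h₁ h₂ => hMTP2.stepUpEvent_inter_mul_le hX
          (C := fun j => Set.Ioi (b (n - j + 1)))
          (fun _ => measurableSet_Ioi) (.inr fun _ => isUpperSet_Ioi _)
          (hCmono j ⟨h₁, h₂.le⟩ (j + 1) ⟨by omega, h₂⟩ (Nat.le_succ j)) _ _ _ _) hq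
      simp only [Nat.sub_self, zero_add] at hle
      linarith
    · rintro hind ⟨c, hc⟩
      rw [measureReal_stepUpEvent_eq_of_indep hkn (hIoi fun j => b (n - j + 1))
        (fun i j hj l hl hjl => Set.preimage_mono (hCmono j hj l hl hjl))
        (p := fun j => 1 - minCDF P X s₀ hne (b (n - j + 1))) (fun s hs j _ => hG s _ hs)
        (fun s j l => measureReal_biInter_inter_stepUpEvent_of_iIndepFun hX hind
          (C := fun j => Set.Ioi (b (n - j + 1))) (fun _ => measurableSet_Ioi) s j k l) hc]
      simp
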